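/- An $m$-prover game $G=(P_{X_{\mathcal M}},\omega)$, $\mathcal M=\{1,\dots,m\}$, consists of finite query alphabets $\mathcal X_i$, finite non-empty response alphabets $\mathcal U_i$ ($i\in\mathcal M$), a probability distribution $P_{X_{\mathcal M}}$ on $\mathcal X_{\mathcal M}=\prod_i\mathcal X_i$, and a predicate $\omega:\mathcal X_{\mathcal M}\times\mathcal U_{\mathcal M}\to\{0,1\}$, where $\mathcal U_{\mathcal M}=\prod_i\mathcal U_i$. For $\mathcal A\subseteq\mathcal M$ write $x_{\mathcal A}=(x_i)_{i\in\mathcal A}$. A sub-nonsignalling strategy is a function $P(u_{\mathcal M}|x_{\mathcal M})\ge 0$ with $\sum_{u_{\mathcal M}}P(u_{\mathcal M}|x_{\mathcal M})\le 1$ for all $x_{\mathcal M}$, such that for every $\mathcal A\subseteq\mathcal M$ there is a channel (conditional probability distribution) $Q(u_{\mathcal A}|x_{\mathcal A})$ with $$\sum_{v_{\mathcal M}:\,v_{\mathcal A}=u_{\mathcal A}}P(v_{\mathcal M}|x_{\mathcal M})\le Q(u_{\mathcal A}|x_{\mathcal A})\qquad\text{for all }x_{\mathcal M},u_{\mathcal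 A}.$$ The sub-nonsignalling value of $G$ is $$\rho_{\mathrm{SNS}}(G)=\max_{P}\sum_{x_{\mathcal M},u_{\mathcal M}}P_{X_{\mathcal M}}(x_{\mathcal M})\,P(u_{\mathcal M}|x_{\mathcal M})\,\omega(x_{\mathcal M},u_{\mathcal M}),$$ the maximum being over all sub-nonsignalling strategies $P$. In $n$ parallel repetitions, $n$ query tuples $x_{\mathcal M,1},\dots,x_{\mathcal M,n}$ are drawn independently from $P_{X_{\mathcal M}}$; prover $i$ receives $x_i^n=(x_{i,1},\dots,x_{i,n})\in\mathcal X_i^n$ and responds with $u_i^n\in\mathcal U_i^n$. Let $N_\omega(x_{\mathcal M}^n,u_{\mathcal M}^n)=\sum_{j=1}^n\omega(x_{\mathcal M,j},u_{\mathcal M,j})$ be the number of wins and let $$\rho_{\mathrm{SNS}}(G^n,\Delta)=\max_{P}\sum_{(x_{\mathcal M}^n,u_{\mathcal M}^n):\,N_\omega(x_{\mathcal M}^n,u_{\mathcal M}^n)\ge n\Delta}\Big(\prod_{j=1}^nP_{X_{\mathcal M}}(x_{\mathcal M,j})\Big)P(u_{\mathcal M}^n|x_{\mathcal M}^n),$$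 the maximum being over all sub-nonsignalling strategies $P$ for the alphabets $\mathcal X_i^n$, $\mathcal U_i^n$. **Theorem.** There are constants $C_m>0$ ($m=0,1,2,\dots$), depending only on $m$, with $C_m=O(2^{2m})$ as $m\to\infty$, such that for every $m$-prover game $G$ with $\rho_{\mathrm{SNS}}(G)<1$, every $\nu$ with $0<\nu\le 1-\rho_{\mathrm{SNS}}(G)$, every $\Delta\ge\rho_{\mathrm{SNS}}(G)+\nu$ and every $n$, $$\rho_{\mathrm{SNS}}(G^n,\Delta)\le\exp\Big(-n\,\frac{\nu^2}{C_m}\Big).$$ -/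

import Mathlib

open scoped BigOperators
open Asymptotics Filter

universe u v

namespace Multiprover

/-- A game with `m` provers, with finite query alphabets `X i` and response alphabets `U i`:
a probability distribution of the tuple of queries, together with a predicate `ω` which says
whether a tuple of responses to a tuple of queries wins. -/
structure Game (m : ℕ) (X : Fin m → Type u) (U : Fin m → Type v) [∀ i, Fintype (X i)] where
  query : (∀ i, X i) → ℝ
  query_mem : query ∈ stdSimplex ℝ (∀ i, X i)
  ω : (∀ i, X i) → (∀ i, U i) → Bool

/-- A channel (conditional distribution) from `S` to the finite set `T`: `Q s t = Q(t|s)`. -/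
def IsChannel {S : Type u} {T : Type v} [Fintype T] (Q : S → T → ℝ) : Prop :=
  ∀ s, Q s ∈ stdSimplex ℝ T

section Strategies

variable {m : ℕ} {X : Fin m → Type u} {U : Fin m → Type v} [∀ i, Fintype (U i)]

open Classical in
/-- The marginal `P_{U_A|X_M}(a|x)` of `P = P_{U_M|X_M}`, where `P x u = P(u|x)`: the sum of
`P(u|x)` over all response tuples `u` whose restriction `u_A` to the provers in `A` is `a`. -/
noncomputable def marginal (P : (∀ i, X i) → (∀ i, U i) → ℝ) (A : Finset (Fin m))
    (x : ∀ i, X i) (a : ∀ i : A, U i) : ℝ :=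
  ∑ u : ∀ i, U i, if A.restrict u = a then P x u else 0

/-- Sub-nonsignalling strategies `P_{U_M|X_M}`: subnormalized, and for every set `A` of provers
the marginal `P_{U_A|X_M}` is dominated by a channel `Q_{U_A|X_A}`. -/
structure IsSubNonsignalling (P : (∀ i, X i) → (∀ i, U i) → ℝ) : Prop where
  nonneg : ∀ x u, 0 ≤ P x u
  sum_le_one : ∀ x, ∑ u, P x u ≤ 1
  dominated : ∀ A : Finset (Fin m),
    ∃ Q : (∀ i : A, X i) → (∀ i : A, U i) → ℝ, IsChannel Q ∧
      ∀ (x : ∀ i, X i) (a : ∀ i : A, U i), marginal P A x a ≤ Q (A.restrict x) a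

variable [∀ i, Fintype (X i)]

open Classical in
/-- The probability of the event `E` when the queries are drawn from `p` and the responses
from the (subnormalized) strategy `P`. -/
noncomputable def prob (p : (∀ i, X i) → ℝ) (P : (∀ i, X i) → (∀ i, U i) → ℝ)
    (E : (∀ i, X i) → (∀ i, U i) → Prop) : ℝ :=
  ∑ x, ∑ u, if E x u then p x * P x u else 0

end Strategies

namespace Game

variable {m : ℕ} {X : Fin m → Type u} {U : Fin m → Type v} [∀ i, Fintype (X i)]

/-- The distribution of the queries in `n` parallel repetitions: the `n` query tuples
`(x i j)_i`, for `j : Fin n`, are independent, and prover `i` receives `x i = (x i j)_j`. -/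
def queryRep (G : Game m X U) (n : ℕ) (x : ∀ i, Fin n → X i) : ℝ :=
  ∏ j, G.query fun i => x i j

/-- The number `N_ω(x, u)` of coordinates that are won in `n` parallel repetitions. -/
def wins (G : Game m X U) (n : ℕ) (x : ∀ i, Fin n → X i) (u : ∀ i, Fin n → U i) : ℕ :=
  ∑ j, if G.ω (fun i => x i j) (fun i => u i j) = true then 1 else 0

variable [∀ i, Fintype (U i)]

/-- The sub-nonsignalling value of the game: the largest winning probability of a
sub-nonsignalling strategy. -/
noncomputable def valueSNS (G : Game m X U) : ℝ :=
  sSup {r : ℝ | ∃ P : (∀ i, X i) → (∀ i, U i) → ℝ, IsSubNonsignalling P ∧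
    r = prob G.query P fun x u => G.ω x u = true}

/-- The largest probability that a sub-nonsignalling strategy for the `n`-fold alphabets
wins at least `n * Δ` of `n` parallel repetitions. -/
noncomputable def valueSNSRep (G : Game m X U) (n : ℕ) (Δ : ℝ) : ℝ :=
  sSup {r : ℝ | ∃ P : (∀ i, Fin n → X i) → (∀ i, Fin n → U i) → ℝ, IsSubNonsignalling P ∧
    r = prob (G.queryRep n) P fun x u => (n : ℝ) * Δ ≤ (G.wins n x u : ℝ)}

end Game

/-! The maxima in the two definitions above exist, so that `sSup` is their value. -/

section Attained

variable {m : ℕ} {X : Fin m → Type u} {U : Fin m → Type v} [∀ i, Fintype (U i)]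

theorem isSubNonsignalling_zero [∀ i, Nonempty (U i)] :
    IsSubNonsignalling fun (_ : ∀ i, X i) (_ : ∀ i, U i) => (0 : ℝ) := by
  classical
  refine ⟨fun _ _ => le_rfl, fun _ => by simp, fun A => ?_⟩
  let a₀ : ∀ i : A, U i := fun i => Classical.arbitrary _
  refine ⟨fun _ a => if a = a₀ then 1 else 0,
    fun s => ⟨fun a => by positivity, by simp⟩, fun x a => ?_⟩
  simp only [marginal, ite_self, Finset.sum_const_zero]
  split_ifs <;> simp

theorem isCompact_isSubNonsignalling :
    IsCompact {P : (∀ i, X i) → (∀ i, U i) → ℝ | IsSubNonsignalling P} := by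
  classical
  let K : Set (((∀ i, X i) → (∀ i, U i) → ℝ) ×
      (∀ A : Finset (Fin m), (∀ i : A, X i) → (∀ i : A, U i) → ℝ)) :=
    (Set.univ.pi fun _ => Set.univ.pi fun _ => Set.Icc 0 1) ×ˢ
      (Set.univ.pi fun _ => Set.univ.pi fun _ => stdSimplex ℝ _)
  have hK : IsCompact K :=
    (isCompact_univ_pi fun _ => isCompact_univ_pi fun _ => isCompact_Icc).prod
      (isCompact_univ_pi fun _ => isCompact_univ_pi fun _ => isCompact_stdSimplex ℝ _)
  let F : Set (((∀ i, X i) → (∀ i, U i) → ℝ) ×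
      (∀ A : Finset (Fin m), (∀ i : A, X i) → (∀ i : A, U i) → ℝ)) :=
    {z | (∀ x, ∑ u, z.1 x u ≤ 1) ∧
      ∀ A x a, marginal z.1 A x a ≤ z.2 A (A.restrict x) a}
  have hF : IsClosed F := by
    refine IsClosed.and ?_ ?_
    · simp only [Set.ofPred_forall]
      refine isClosed_iInter fun x => ?_
      exact isClosed_le (by fun_prop) continuous_const
    · simp only [Set.ofPred_forall]
      refine isClosed_iInter fun A => isClosed_iInter fun x => isClosed_iInter fun a => ?_
      refine isClosed_le ?_ (by fun_prop)
      unfold marginal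
      refine continuous_finsetSum _ fun u _ => ?_
      split_ifs <;> fun_prop
  convert (hK.inter_right hF).image continuous_fst
  ext P
  constructor
  · intro h
    choose Q hQ hPQ using h.dominated
    refine ⟨(P, Q), ⟨⟨fun x _ u _ => ⟨h.nonneg x u, ?_⟩, fun A _ s _ => hQ A s⟩,
      h.sum_le_one, hPQ⟩, rfl⟩
    exact (Finset.single_le_sum (f := P x) (fun v _ => h.nonneg x v)
      (Finset.mem_univ u)).trans (h.sum_le_one x)
  · rintro ⟨⟨P, Q⟩, ⟨⟨h₁, h₂⟩, h₃, h₄⟩, rfl⟩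
    exact ⟨fun x u => (h₁ x trivial u trivial).1, h₃,
      fun A => ⟨Q A, fun s => h₂ A trivial s trivial, h₄ A⟩⟩

variable [∀ i, Fintype (X i)] [∀ i, Nonempty (U i)]

theorem isGreatest_prob (p : (∀ i, X i) → ℝ) (E : (∀ i, X i) → (∀ i, U i) → Prop) :
    IsGreatest {r : ℝ | ∃ P, IsSubNonsignalling P ∧ r = prob p P E}
      (sSup {r : ℝ | ∃ P, IsSubNonsignalling P ∧ r = prob p P E}) := by
  classical
  have hc : Continuous fun P : (∀ i, X i) → (∀ i, U i) → ℝ => prob p P E := by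
    unfold prob
    refine continuous_finsetSum _ fun x _ => continuous_finsetSum _ fun u _ => ?_
    split_ifs <;> fun_prop
  have hs : {r : ℝ | ∃ P, IsSubNonsignalling P ∧ r = prob p P E} =
      (fun P => prob p P E) '' {P | IsSubNonsignalling P} := by
    ext r
    simp [eq_comm]
  rw [hs]
  exact (isCompact_isSubNonsignalling.image hc).isGreatest_sSup
    ⟨_, _, isSubNonsignalling_zero, rfl⟩

theorem Game.isGreatest_valueSNS (G : Game m X U) :
    IsGreatest {r : ℝ | ∃ P : (∀ i, X i) → (∀ i, U i) → ℝ, IsSubNonsignalling P ∧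
      r = prob G.query P fun x u => G.ω x u = true} G.valueSNS :=
  isGreatest_prob _ _

theorem Game.isGreatest_valueSNSRep (G : Game m X U) (n : ℕ) (Δ : ℝ) :
    IsGreatest {r : ℝ | ∃ P : (∀ i, Fin n → X i) → (∀ i, Fin n → U i) → ℝ,
      IsSubNonsignalling P ∧
        r = prob (G.queryRep n) P fun x u => (n : ℝ) * Δ ≤ (G.wins n x u : ℝ)}
      (G.valueSNSRep n Δ) :=
  isGreatest_prob _ _

end Attained

end Multiprover

/-! Let a strategy `P` win at least `n * Δ` rounds with probability `q > 0`. Conditioning queries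
and responses on that event gives `R`; averaging its one-round marginals gives a joint distribution
`t` which wins the single game with probability at least `Δ`. Write `p` for the query distribution.
If `t(x, u_A)` were close to `p(x) t(u_A|x_A)` for every `A`, then `t` could be rounded to a
sub-nonsignalling strategy with nearly the same value (`exists_isSubNonsignalling_prob_ge`). That
value is at most `Δ - ν`, so some `A` among the `2 ^ m` has deviation at least `δ = ν / 2 ^ m`, and
Pinsker (`sq_sum_mul_max_le`) turns this into relative entropy at least `δ ^ 2 / 2`. Conversely, `n`
times this entropy is the `R`-mean of the log of the product of the inverse `ratio`s. That product
has `P`-mean at most 1 because `P` is dominated by a channel on `A`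
(`sum_queryRep_mul_prod_inv_ratio_le_one`). Conditioning raises weights by at most `1 / q`, so the
mean log is at most `-log q`. Hence `n * δ ^ 2 / 2 ≤ -log q`. -/

namespace Multiprover

/-! ### Marginals of a joint weight, and their conditional distributions. -/

section Marginals

variable {m : ℕ} {X : Fin m → Type u} {U : Fin m → Type v} [∀ i, Fintype (U i)]

theorem sum_mul_restrict (P : (∀ i, X i) → (∀ i, U i) → ℝ) (A : Finset (Fin m))
    (x : ∀ i, X i) (g : (∀ i : A, U i) → ℝ) :
    ∑ u, P x u * g (A.restrict u) = ∑ a, marginal P A x a * g a := by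
  classical
  simp only [marginal, Finset.sum_mul]
  rw [Finset.sum_comm]
  refine Finset.sum_congr rfl fun u _ => ?_
  simp [ite_mul]

theorem marginal_nonneg {P : (∀ i, X i) → (∀ i, U i) → ℝ} (h : ∀ x u, 0 ≤ P x u)
    (A : Finset (Fin m)) (x : ∀ i, X i) (a : ∀ i : A, U i) : 0 ≤ marginal P A x a := by
  unfold marginal
  exact Finset.sum_nonneg fun u _ => by split_ifs <;> simp [h]

theorem le_marginal {P : (∀ i, X i) → (∀ i, U i) → ℝ} (h : ∀ x u, 0 ≤ P x u)
    (A : Finset (Fin m)) (x : ∀ i, X i) (u : ∀ i, U i) :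
    P x u ≤ marginal P A x (A.restrict u) := by
  classical
  unfold marginal
  refine le_trans (by simp) (Finset.single_le_sum
    (f := fun v => if A.restrict v = A.restrict u then P x v else 0)
    (fun v _ => by split_ifs <;> simp [h]) (Finset.mem_univ u))

variable [∀ i, Fintype (X i)]

open Classical in
/-- The marginal `t(x_A, u_A)` of a joint weight `t(x, u)`. -/
noncomputable def jointMarginal (t : (∀ i, X i) → (∀ i, U i) → ℝ) (A : Finset (Fin m))
    (y : ∀ i : A, X i) (a : ∀ i : A, U i) : ℝ :=
  ∑ x : ∀ i, X i, if A.restrict x = y then marginal t A x a else 0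

/-- The marginal `t(x_A)` of a joint weight `t(x, u)`. -/
noncomputable def queryMarginal (t : (∀ i, X i) → (∀ i, U i) → ℝ) (A : Finset (Fin m))
    (y : ∀ i : A, X i) : ℝ :=
  ∑ a, jointMarginal t A y a

/-- The density of `p(x) t(u_A|x_A)` with respect to `t(x, u_A)`. -/
noncomputable def ratio (p : (∀ i, X i) → ℝ) (t : (∀ i, X i) → (∀ i, U i) → ℝ)
    (A : Finset (Fin m)) (x : ∀ i, X i) (a : ∀ i : A, U i) : ℝ :=
  p x * jointMarginal t A (A.restrict x) a /
    (queryMarginal t A (A.restrict x) * marginal t A x a)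

variable {t : (∀ i, X i) → (∀ i, U i) → ℝ}

theorem jointMarginal_nonneg (h : ∀ x u, 0 ≤ t x u)
    (A : Finset (Fin m)) (y : ∀ i : A, X i) (a : ∀ i : A, U i) : 0 ≤ jointMarginal t A y a := by
  unfold jointMarginal
  exact Finset.sum_nonneg fun u _ => by split_ifs <;> simp [marginal_nonneg h]

theorem queryMarginal_nonneg (h : ∀ x u, 0 ≤ t x u)
    (A : Finset (Fin m)) (y : ∀ i : A, X i) : 0 ≤ queryMarginal t A y :=
  Finset.sum_nonneg fun a _ => jointMarginal_nonneg h A y a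

theorem marginal_le_jointMarginal (h : ∀ x u, 0 ≤ t x u)
    (A : Finset (Fin m)) (x : ∀ i, X i) (a : ∀ i : A, U i) :
    marginal t A x a ≤ jointMarginal t A (A.restrict x) a := by
  classical
  unfold jointMarginal
  refine le_trans (by simp) (Finset.single_le_sum
    (f := fun z => if A.restrict z = A.restrict x then marginal t A z a else 0)
    (fun v _ => by split_ifs <;> simp [marginal_nonneg h]) (Finset.mem_univ x))

theorem jointMarginal_le_queryMarginal (h : ∀ x u, 0 ≤ t x u)
    (A : Finset (Fin m)) (y : ∀ i : A, X i) (a : ∀ i : A, U i) :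
    jointMarginal t A y a ≤ queryMarginal t A y :=
  Finset.single_le_sum (f := jointMarginal t A y)
    (fun b _ => jointMarginal_nonneg h A y b) (Finset.mem_univ a)

theorem ratio_nonneg {p : (∀ i, X i) → ℝ} (hp : ∀ x, 0 ≤ p x) (h : ∀ x u, 0 ≤ t x u)
    (A : Finset (Fin m)) (x : ∀ i, X i) (a : ∀ i : A, U i) : 0 ≤ ratio p t A x a :=
  div_nonneg (mul_nonneg (hp x) (jointMarginal_nonneg h _ _ _))
    (mul_nonneg (queryMarginal_nonneg h _ _) (marginal_nonneg h _ _ _))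

theorem ratio_pos {p : (∀ i, X i) → ℝ} (h : ∀ x u, 0 ≤ t x u) (A : Finset (Fin m))
    {x : ∀ i, X i} {u : ∀ i, U i} (hpx : 0 < p x) (htx : 0 < t x u) :
    0 < ratio p t A x (A.restrict u) := by
  have h₁ := htx.trans_le (le_marginal h A x u)
  have h₂ := h₁.trans_le (marginal_le_jointMarginal h A x _)
  have h₃ := h₂.trans_le (jointMarginal_le_queryMarginal h A _ _)
  unfold ratio
  positivity

theorem sum_queryMarginal (A : Finset (Fin m)) :
    ∑ y, queryMarginal t A y = ∑ x, ∑ u, t x u := by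
  classical
  simp only [queryMarginal, jointMarginal]
  rw [Finset.sum_comm]
  have (a : ∀ i : A, U i) : ∑ y : ∀ i : A, X i, ∑ x : ∀ i, X i,
      (if A.restrict x = y then marginal t A x a else 0) = ∑ x, marginal t A x a := by
    rw [Finset.sum_comm]
    simp
  simp only [this]
  rw [Finset.sum_comm]
  refine Finset.sum_congr rfl fun x _ => ?_
  simpa using (sum_mul_restrict t A x fun _ => 1).symm

/-- The conditional distribution `t(u_A|x_A)`, with a fixed response where `t(x_A) = 0`. -/
theorem exists_isChannel_conditional [∀ i, Nonempty (U i)] (h : ∀ x u, 0 ≤ t x u)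
    (A : Finset (Fin m)) :
    ∃ Q : (∀ i : A, X i) → (∀ i : A, U i) → ℝ, IsChannel Q ∧
      ∀ y a, jointMarginal t A y a / queryMarginal t A y ≤ Q y a := by
  classical
  let a₀ : ∀ i : A, U i := fun i => Classical.arbitrary _
  refine ⟨fun y a => if queryMarginal t A y = 0 then (if a = a₀ then 1 else 0) else
    jointMarginal t A y a / queryMarginal t A y, fun y => ?_, fun y a => ?_⟩
  · by_cases hy : queryMarginal t A y = 0
    · simp only [hy, if_true]
      exact ⟨fun a => by positivity, by simp⟩
    · simp only [hy, if_false]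
      refine ⟨fun a => div_nonneg (jointMarginal_nonneg h _ _ _) (queryMarginal_nonneg h _ _), ?_⟩
      rw [← Finset.sum_div]
      exact div_self hy
  · by_cases hy : queryMarginal t A y = 0
    · simp only [hy, if_true, div_zero]
      positivity
    · simp [hy]

/-- The marginal cancels from `ratio`. Equality can fail where the marginal vanishes: the left side
is then 0, while the right side may be positive. -/
theorem marginal_mul_ratio_le {p : (∀ i, X i) → ℝ} (hp : ∀ x, 0 ≤ p x) (h : ∀ x u, 0 ≤ t x u)
    (A : Finset (Fin m)) (x : ∀ i, X i) (a : ∀ i : A, U i) :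
    marginal t A x a * ratio p t A x a ≤
      p x * (jointMarginal t A (A.restrict x) a / queryMarginal t A (A.restrict x)) := by
  have hR : 0 ≤ p x * (jointMarginal t A (A.restrict x) a / queryMarginal t A (A.restrict x)) :=
    mul_nonneg (hp x) (div_nonneg (jointMarginal_nonneg h _ _ _) (queryMarginal_nonneg h _ _))
  by_cases hm : marginal t A x a = 0
  · simpa [hm] using hR
  · apply le_of_eq
    unfold ratio
    rw [mul_comm (queryMarginal _ _ _), ← div_div, mul_div_assoc', mul_div_cancel₀ _ hm,
      mul_div_assoc]

theorem sum_mul_ratio_le_one [∀ i, Nonempty (U i)] {p : (∀ i, X i) → ℝ}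
    (hp : p ∈ stdSimplex ℝ (∀ i, X i)) (h : ∀ x u, 0 ≤ t x u) (A : Finset (Fin m)) :
    ∑ x, ∑ u, t x u * ratio p t A x (A.restrict u) ≤ 1 := by
  obtain ⟨Q, hQ, hle⟩ := exists_isChannel_conditional h A
  rw [← hp.2]
  refine Finset.sum_le_sum fun x _ => ?_
  rw [sum_mul_restrict t A x]
  calc _ ≤ ∑ a, p x * Q (A.restrict x) a := Finset.sum_le_sum fun a _ =>
        (marginal_mul_ratio_le hp.1 h A x a).trans
          (mul_le_mul_of_nonneg_left (hle _ _) (hp.1 x))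
    _ = p x := by rw [← Finset.mul_sum, (hQ _).2, mul_one]

/-! ### Pinsker's inequality and rounding for the single game. -/

/-- For `r ≤ 1` these are the first two terms of the series of `-log (1 - s)` at `s = 1 - r`, whose
terms are all nonnegative. -/
theorem neg_log_ge_one_sub_add_sq {r : ℝ} (hr : 0 < r) :
    (1 - r) + (max (1 - r) 0) ^ 2 / 2 ≤ -Real.log r := by
  rcases le_total r 1 with h | h
  · rw [max_eq_left (by linarith)]
    have hs := Real.hasSum_pow_div_log_of_abs_lt_one (x := 1 - r)
      (abs_lt.2 ⟨by linarith, by linarith⟩)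
    have h₁ := sum_le_hasSum (Finset.range 2)
      (fun i _ => div_nonneg (pow_nonneg (sub_nonneg.2 h) (i + 1)) (by positivity)) hs
    norm_num [Finset.sum_range_succ] at h₁
    linarith
  · rw [max_eq_right (by linarith)]
    linarith [Real.log_le_sub_one_of_pos hr]

/-- A form of Pinsker's inequality for `t(x, u_A)` and `p(x) t(u_A|x_A)`. -/
theorem sq_sum_mul_max_le [∀ i, Nonempty (U i)] {p : (∀ i, X i) → ℝ}
    (hp : p ∈ stdSimplex ℝ (∀ i, X i)) (h : ∀ x u, 0 ≤ t x u) (h1 : ∑ x, ∑ u, t x u = 1)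
    (hpt : ∀ x u, 0 < t x u → 0 < p x) (A : Finset (Fin m)) :
    (∑ x, ∑ u, t x u * max (1 - ratio p t A x (A.restrict u)) 0) ^ 2 / 2 ≤
      ∑ x, ∑ u, t x u * -Real.log (ratio p t A x (A.restrict u)) := by
  set r := fun x u => ratio p t A x (A.restrict u) with hr
  set δ := ∑ x, ∑ u, t x u * max (1 - r x u) 0 with hδ
  -- The square `b ^ 2 / 2` is replaced by its tangent `δ * b - δ ^ 2 / 2` at the mean `δ`. This
  -- averages to `δ ^ 2 / 2`, and `1 - r` has nonnegative mean.
  have key : ∀ x u, t x u * ((1 - r x u) + (δ * max (1 - r x u) 0 - δ ^ 2 / 2)) ≤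
      t x u * -Real.log (r x u) := by
    intro x u
    rcases (h x u).eq_or_lt with h0 | h0
    · simp [← h0]
    · refine mul_le_mul_of_nonneg_left ?_ h0.le
      have := neg_log_ge_one_sub_add_sq (ratio_pos h A (hpt x u h0) h0)
      simp only [hr]
      nlinarith [sq_nonneg (max (1 - ratio p t A x (A.restrict u)) 0 - δ)]
  have hsum := Finset.sum_le_sum fun x (_ : x ∈ Finset.univ) =>
    Finset.sum_le_sum fun u (_ : u ∈ Finset.univ) => key x u
  have hle : ∑ x, ∑ u, t x u * r x u ≤ 1 := sum_mul_ratio_le_one hp h A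
  have heq (d : ℝ) : ∑ x, ∑ u, t x u * ((1 - r x u) + (d * max (1 - r x u) 0 - d ^ 2 / 2)) =
      (∑ x, ∑ u, t x u) - (∑ x, ∑ u, t x u * r x u) +
        d * (∑ x, ∑ u, t x u * max (1 - r x u) 0) - (∑ x, ∑ u, t x u) * (d ^ 2 / 2) := by
    simp only [Finset.mul_sum, Finset.sum_mul, ← Finset.sum_sub_distrib, ← Finset.sum_add_distrib]
    refine Finset.sum_congr rfl fun x _ => Finset.sum_congr rfl fun u _ => ?_
    ring
  rw [heq, h1, ← hδ] at hsum
  nlinarith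

/-- A joint distribution `t` of queries and responses is rounded to a sub-nonsignalling strategy;
the loss is the total deviation of the `t(x, u_A)` from `p(x) t(u_A|x_A)`. -/
theorem exists_isSubNonsignalling_prob_ge [∀ i, Nonempty (U i)] {p : (∀ i, X i) → ℝ}
    (hp : ∀ x, 0 ≤ p x) (h : ∀ x u, 0 ≤ t x u)
    (hpt : ∀ x u, 0 < t x u → 0 < p x) (w : (∀ i, X i) → (∀ i, U i) → Bool) :
    ∃ P : (∀ i, X i) → (∀ i, U i) → ℝ, IsSubNonsignalling P ∧
      (∑ x, ∑ u, t x u * (if w x u = true then 1 else 0)) -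
        ∑ A : Finset (Fin m), ∑ x, ∑ u, t x u * max (1 - ratio p t A x (A.restrict u)) 0 ≤
      prob p P fun x u => w x u = true := by
  classical
  -- The damping factor for `t(u|x)`: being below every ratio it enforces all dominations at once,
  -- and `1 - c` is at most the sum of the deficits.
  let c : (∀ i, X i) → (∀ i, U i) → ℝ := fun x u =>
    Finset.univ.inf' Finset.univ_nonempty
      fun A : Finset (Fin m) => min 1 (ratio p t A x (A.restrict u))
  have hc0 : ∀ x u, 0 ≤ c x u := fun x u =>
    (Finset.le_inf'_iff _ _).2 fun A _ => le_min zero_le_one (ratio_nonneg hp h _ _ _)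
  have hcr : ∀ A x u, c x u ≤ ratio p t A x (A.restrict u) := fun A x u =>
    (Finset.inf'_le (fun A : Finset (Fin m) => min 1 (ratio p t A x (A.restrict u)))
      (Finset.mem_univ A)).trans (min_le_right _ _)
  have hcs : ∀ x u, 1 - ∑ A : Finset (Fin m), max (1 - ratio p t A x (A.restrict u)) 0 ≤ c x u := by
    intro x u
    refine (Finset.le_inf'_iff _ _).2 fun A _ => ?_
    have := Finset.single_le_sum
      (f := fun A : Finset (Fin m) => max (1 - ratio p t A x (A.restrict u)) 0)
      (fun A _ => le_max_right _ _) (Finset.mem_univ A)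
    refine le_min ?_ ?_
    · linarith [this, le_max_right (1 - ratio p t A x (A.restrict u)) 0]
    · linarith [this, le_max_left (1 - ratio p t A x (A.restrict u)) 0]
  have hf0 : ∀ x u, 0 ≤ t x u / p x * c x u := fun x u =>
    mul_nonneg (div_nonneg (h x u) (hp x)) (hc0 x u)
  have hdom : ∀ A : Finset (Fin m), ∃ Q : (∀ i : A, X i) → (∀ i : A, U i) → ℝ, IsChannel Q ∧
      ∀ (x : ∀ i, X i) (a : ∀ i : A, U i),
        marginal (fun x u => t x u / p x * c x u) A x a ≤ Q (A.restrict x) a := by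
    intro A
    obtain ⟨Q, hQ, hle⟩ := exists_isChannel_conditional h A
    refine ⟨Q, hQ, fun x a => ?_⟩
    have h₁ : marginal (fun x u => t x u / p x * c x u) A x a ≤
        marginal t A x a * ratio p t A x a / p x := by
      unfold marginal
      rw [Finset.sum_mul, Finset.sum_div]
      refine Finset.sum_le_sum fun u _ => ?_
      split_ifs with hu
      · subst hu
        have := mul_le_mul_of_nonneg_left (hcr A x u) (div_nonneg (h x u) (hp x))
        refine this.trans_eq ?_
        ring
      · simp
    rcases (hp x).eq_or_lt with hx | hx
    · refine h₁.trans ?_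
      rw [← hx, div_zero]
      exact (hQ _).1 a
    · refine h₁.trans (le_trans ?_ (hle _ a))
      rw [div_le_iff₀ hx, mul_comm _ (p x)]
      exact marginal_mul_ratio_le hp h A x a
  refine ⟨_, ⟨hf0, fun x => ?_, hdom⟩, ?_⟩
  -- Domination for `A = ∅` is exactly subnormalization.
  · obtain ⟨Q, hQ, hle⟩ := hdom ∅
    have := sum_mul_restrict (fun x u => t x u / p x * c x u) ∅ x fun _ => 1
    simp_rw [mul_one] at this
    rw [this, ← (hQ (Finset.restrict ∅ x)).2]
    exact Finset.sum_le_sum fun a _ => hle x a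
  · have hswap : ∑ A : Finset (Fin m), ∑ x, ∑ u,
        t x u * max (1 - ratio p t A x (A.restrict u)) 0 =
        ∑ x, ∑ u, t x u * ∑ A : Finset (Fin m), max (1 - ratio p t A x (A.restrict u)) 0 := by
      rw [Finset.sum_comm]
      refine Finset.sum_congr rfl fun x _ => ?_
      rw [Finset.sum_comm]
      simp only [Finset.mul_sum]
    rw [hswap]
    simp only [prob, ← Finset.sum_sub_distrib]
    refine Finset.sum_le_sum fun x _ => Finset.sum_le_sum fun u _ => ?_
    have hS : 0 ≤ ∑ A : Finset (Fin m), max (1 - ratio p t A x (A.restrict u)) 0 :=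
      Finset.sum_nonneg fun A _ => le_max_right _ _
    split_ifs with hw
    · rcases (h x u).eq_or_lt with h0 | h0
      · simp [← h0]
      · have : p x * (t x u / p x * c x u) = t x u * c x u := by
          have := (hpt x u h0).ne'
          field_simp
        rw [this]
        nlinarith [hcs x u]
    · nlinarith [mul_nonneg (h x u) hS]

end Marginals

/-! ### Product structure of the repeated queries. -/

theorem sum_prod_coordinates {ι : Type*} [Fintype ι] [DecidableEq ι] {X : ι → Type*}
    [∀ i, Fintype (X i)]
    (n : ℕ) (F : Fin n → (∀ i, X i) → ℝ) :
    ∑ x : ∀ i, Fin n → X i, ∏ j, F j (fun i => x i j) = ∏ j, ∑ y, F j y := by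
  classical
  rw [Finset.prod_univ_sum, Fintype.piFinset_univ]
  exact Fintype.sum_equiv (Equiv.piComm _) _ _ fun x => rfl

theorem prob_le_one {m : ℕ} {X : Fin m → Type u} {U : Fin m → Type v}
    [∀ i, Fintype (X i)] [∀ i, Fintype (U i)] {p : (∀ i, X i) → ℝ}
    (hp : p ∈ stdSimplex ℝ (∀ i, X i)) {P : (∀ i, X i) → (∀ i, U i) → ℝ}
    (hP : IsSubNonsignalling P) (E : (∀ i, X i) → (∀ i, U i) → Prop) : prob p P E ≤ 1 := by
  rw [← hp.2]
  refine Finset.sum_le_sum fun x _ => ?_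
  calc _ ≤ ∑ u, p x * P x u := Finset.sum_le_sum fun u _ => by
        split_ifs
        · exact le_rfl
        · exact mul_nonneg (hp.1 x) (hP.nonneg x u)
    _ ≤ p x := by
        rw [← Finset.mul_sum]
        exact mul_le_of_le_one_right (hp.1 x) (hP.sum_le_one x)

theorem Game.queryRep_mem {m : ℕ} {X : Fin m → Type u} {U : Fin m → Type v}
    [∀ i, Fintype (X i)] (G : Game m X U) (n : ℕ) :
    G.queryRep n ∈ stdSimplex ℝ (∀ i, Fin n → X i) := by
  refine ⟨fun x => Finset.prod_nonneg fun j _ => G.query_mem.1 _, ?_⟩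
  simp only [Game.queryRep]
  rw [sum_prod_coordinates n fun _ => G.query, G.query_mem.2]
  simp

/-! ### Change of measure for the repeated game. -/

section Repetition

variable {m : ℕ} {X : Fin m → Type u} {U : Fin m → Type v}
  [∀ i, Fintype (X i)] [∀ i, Fintype (U i)]
  {t : (∀ i, X i) → (∀ i, U i) → ℝ}

open Classical in
-- Where `p(x) > 0`, it cancels and leaves `t(x_A) t(x|x_A, u_A)`, a conditional distribution to be
-- summed over the queries outside `A`.
theorem sum_mul_inv_ratio_le {p : (∀ i, X i) → ℝ} (h : ∀ x u, 0 ≤ t x u) (A : Finset (Fin m))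
    (y : ∀ i : A, X i) (a : ∀ i : A, U i) :
    ∑ x, (if A.restrict x = y then p x * (ratio p t A x a)⁻¹ else 0) ≤ queryMarginal t A y := by
  have hq := queryMarginal_nonneg h A y
  have hj := jointMarginal_nonneg h A y a
  calc _ ≤ ∑ x, (if A.restrict x = y then marginal t A x a else 0) *
        (queryMarginal t A y / jointMarginal t A y a) := by
        refine Finset.sum_le_sum fun x _ => ?_
        split_ifs with hx
        · subst hx
          have hm := marginal_nonneg h A x a
          by_cases hp : p x = 0
          · rw [hp, zero_mul]
            positivity
          · apply le_of_eq
            unfold ratio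
            rw [inv_div]
            field_simp
        · simp
    _ = jointMarginal t A y a * (queryMarginal t A y / jointMarginal t A y a) := by
        rw [← Finset.sum_mul, jointMarginal]
    _ ≤ _ := by
        rcases hj.eq_or_lt with h0 | h0
        · simpa [← h0] using hq
        · rw [mul_div_cancel₀ _ h0.ne']

/-- The likelihood ratio against the product distribution has expectation at most one under
every sub-nonsignalling strategy for the repeated game. -/
theorem sum_queryRep_mul_prod_inv_ratio_le_one (G : Game m X U) (h : ∀ x u, 0 ≤ t x u)
    (h1 : ∑ x, ∑ u, t x u = 1) {n : ℕ} {P : (∀ i, Fin n → X i) → (∀ i, Fin n → U i) → ℝ}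
    (hP : IsSubNonsignalling P) (A : Finset (Fin m)) :
    ∑ x, ∑ u, G.queryRep n x * P x u *
      ∏ j, (ratio G.query t A (fun i => x i j) (A.restrict fun i => u i j))⁻¹ ≤ 1 := by
  classical
  obtain ⟨Q, hQ, hle⟩ := hP.dominated A
  have hk (x : ∀ i, X i) (a : ∀ i : A, U i) :
      0 ≤ G.query x * (ratio G.query t A x a)⁻¹ :=
    mul_nonneg (G.query_mem.1 x) (inv_nonneg.2 (ratio_nonneg G.query_mem.1 h _ _ _))
  calc _ = ∑ x : ∀ i, Fin n → X i, ∑ a : ∀ i : A, Fin n → U i, marginal P A x a *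
        ∏ j, (G.query (fun i => x i j) *
          (ratio G.query t A (fun i => x i j) (fun i => a i j))⁻¹) := by
        refine Finset.sum_congr rfl fun x _ => ?_
        rw [← sum_mul_restrict P A x]
        refine Finset.sum_congr rfl fun u _ => ?_
        rw [Finset.prod_mul_distrib, Game.queryRep]
        simp only [Finset.restrict_def]
        ring
    _ ≤ ∑ x : ∀ i, Fin n → X i, ∑ a : ∀ i : A, Fin n → U i, Q (A.restrict x) a *
        ∏ j, (G.query (fun i => x i j) *
          (ratio G.query t A (fun i => x i j) (fun i => a i j))⁻¹) :=
        Finset.sum_le_sum fun x _ => Finset.sum_le_sum fun a _ =>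
          mul_le_mul_of_nonneg_right (hle x a) (Finset.prod_nonneg fun j _ => hk _ _)
    -- Since `Q` sees only the queries in `A`, the sum over the other queries factors over the
    -- rounds.
    _ = ∑ y : ∀ i : A, Fin n → X i, ∑ a : ∀ i : A, Fin n → U i,
        Q y a * ∏ j, ∑ z, (if A.restrict z = (fun i => y i j) then
          G.query z * (ratio G.query t A z (fun i => a i j))⁻¹ else 0) := by
        simp only [← sum_prod_coordinates, Finset.mul_sum]
        have e (y : ∀ i : A, Fin n → X i) (a : ∀ i : A, Fin n → U i) (x : ∀ i, Fin n → X i) :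
            (∏ j, if A.restrict (fun i => x i j) = (fun i => y i j) then
              G.query (fun i => x i j) *
              (ratio G.query t A (fun i => x i j) (fun i => a i j))⁻¹ else 0) =
            if A.restrict x = y then ∏ j, G.query (fun i => x i j) *
              (ratio G.query t A (fun i => x i j) (fun i => a i j))⁻¹ else 0 := by
          split_ifs with hx
          · subst hx
            refine Finset.prod_congr rfl fun j _ => ?_
            exact if_pos rfl
          · have : ∃ j, A.restrict (fun i => x i j) ≠ (fun i => y i j) := by
              by_contra! hc
              exact hx (funext fun i => funext fun j => congrFun (hc j) i)
            obtain ⟨j, hj⟩ := this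
            exact Finset.prod_eq_zero (Finset.mem_univ j) (if_neg hj)
        simp only [e]
        have e2 (y : ∀ i : A, Fin n → X i) := Finset.sum_comm (s := Finset.univ)
          (t := Finset.univ) (f := fun (a : ∀ i : A, Fin n → U i) (x : ∀ i, Fin n → X i) =>
          Q y a * if A.restrict x = y then ∏ j, G.query (fun i => x i j) *
              (ratio G.query t A (fun i => x i j) (fun i => a i j))⁻¹ else 0)
        simp only [e2]
        symm
        rw [Finset.sum_comm]
        refine Finset.sum_congr rfl fun x _ => ?_
        rw [Finset.sum_comm]
        refine Finset.sum_congr rfl fun a _ => ?_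
        simp
    -- The bound on each factor no longer depends on `a`, so `Q` can be summed out next.
    _ ≤ ∑ y : ∀ i : A, Fin n → X i, ∑ a : ∀ i : A, Fin n → U i,
        Q y a * ∏ j, queryMarginal t A (fun i => y i j) := by
        refine Finset.sum_le_sum fun y _ => Finset.sum_le_sum fun a _ =>
          mul_le_mul_of_nonneg_left ?_ ((hQ y).1 a)
        refine Finset.prod_le_prod (fun j _ => Finset.sum_nonneg
          fun (z : ∀ i, X i) _ => ?_) fun j _ => sum_mul_inv_ratio_le h A _ _
        split_ifs
        · exact hk _ _
        · exact le_rfl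
    _ = ∑ y : ∀ i : A, Fin n → X i, ∏ j, queryMarginal t A (fun i => y i j) := by
        refine Finset.sum_congr rfl fun y _ => ?_
        rw [← Finset.sum_mul, (hQ y).2, one_mul]
    _ = 1 := by
        rw [sum_prod_coordinates n fun _ => queryMarginal t A, sum_queryMarginal, h1]
        simp

/-! ### Passing from `n` rounds to one. -/

open Classical in
/-- The average over the coordinates of the single-coordinate marginals of `R`. -/
noncomputable def coordinateAverage {n : ℕ} (R : (∀ i, Fin n → X i) → (∀ i, Fin n → U i) → ℝ)
    (y : ∀ i, X i) (v : ∀ i, U i) : ℝ :=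
  (n : ℝ)⁻¹ * ∑ x, ∑ u, R x u *
    ∑ j, if (fun i => x i j) = y ∧ (fun i => u i j) = v then 1 else 0

/-- Used for the total mass, the win rate and the log-likelihood, all of which are additive over
rounds. -/
theorem sum_coordinateAverage_mul {n : ℕ} (R : (∀ i, Fin n → X i) → (∀ i, Fin n → U i) → ℝ)
    (g : (∀ i, X i) → (∀ i, U i) → ℝ) :
    ∑ y, ∑ v, coordinateAverage R y v * g y v =
      (n : ℝ)⁻¹ * ∑ x, ∑ u, R x u * ∑ j, g (fun i => x i j) (fun i => u i j) := by
  classical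
  have e (x : ∀ i, Fin n → X i) (u : ∀ i, Fin n → U i) (j : Fin n) :
      g (fun i => x i j) (fun i => u i j) = ∑ y, ∑ v,
        (if (fun i => x i j) = y ∧ (fun i => u i j) = v then 1 else 0) * g y v := by
    simp [ite_and]
  have hc {α β : Type _} [Fintype α] [Fintype β] (R : α → ℝ) (I : α → Fin n → β → ℝ)
      (g : β → ℝ) : ∑ z, ((n : ℝ)⁻¹ * ∑ w, R w * ∑ j, I w j z) * g z =
      (n : ℝ)⁻¹ * ∑ w, R w * ∑ j, ∑ z, I w j z * g z := by
    simp only [Finset.mul_sum, Finset.sum_mul]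
    rw [Finset.sum_comm]
    refine Finset.sum_congr rfl fun w _ => ?_
    rw [Finset.sum_comm]
    simp only [mul_assoc]
  simp only [e, coordinateAverage]
  simpa only [Fintype.sum_prod_type] using hc (fun w => R w.1 w.2)
    (fun (w : (∀ i, Fin n → X i) × (∀ i, Fin n → U i)) j (z : (∀ i, X i) × (∀ i, U i)) =>
      if (fun i => w.1 i j) = z.1 ∧ (fun i => w.2 i j) = z.2 then 1 else 0) (fun z => g z.1 z.2)

theorem coordinateAverage_nonneg {n : ℕ}
    {R : (∀ i, Fin n → X i) → (∀ i, Fin n → U i) → ℝ} (hR : ∀ x u, 0 ≤ R x u)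
    (y : ∀ i, X i) (v : ∀ i, U i) : 0 ≤ coordinateAverage R y v := by
  refine mul_nonneg (by positivity) (Finset.sum_nonneg fun x _ => Finset.sum_nonneg fun u _ =>
    mul_nonneg (hR x u) (Finset.sum_nonneg fun j _ => ?_))
  split_ifs <;> simp

theorem coordinateAverage_pos {n : ℕ}
    {R : (∀ i, Fin n → X i) → (∀ i, Fin n → U i) → ℝ} (hR : ∀ x u, 0 ≤ R x u)
    {x : ∀ i, Fin n → X i} {u : ∀ i, Fin n → U i} (h : 0 < R x u) (j : Fin n) :
    0 < coordinateAverage R (fun i => x i j) (fun i => u i j) := by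
  classical
  have hn : (0 : ℝ) < n := Nat.cast_pos.2 (j.pos)
  have hi (x' : ∀ i, Fin n → X i) (u' : ∀ i, Fin n → U i) : (0 : ℝ) ≤ ∑ k,
      if (fun i => x' i k) = (fun i => x i j) ∧ (fun i => u' i k) = (fun i => u i j)
        then 1 else 0 := by positivity
  refine mul_pos (by positivity) (Finset.sum_pos' (fun x' _ => Finset.sum_nonneg fun u' _ =>
    mul_nonneg (hR _ _) (hi x' u')) ⟨x, Finset.mem_univ _, Finset.sum_pos' (fun u' _ =>
    mul_nonneg (hR _ _) (hi x u')) ⟨u, Finset.mem_univ _, mul_pos h ?_⟩⟩)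
  exact Finset.sum_pos' (fun k _ => by positivity) ⟨j, Finset.mem_univ _, by simp⟩

theorem exists_pos_of_coordinateAverage_pos {n : ℕ}
    {R : (∀ i, Fin n → X i) → (∀ i, Fin n → U i) → ℝ}
    {y : ∀ i, X i} {v : ∀ i, U i} (h : 0 < coordinateAverage R y v) :
    ∃ x u j, R x u ≠ 0 ∧ (fun i => x i j) = y ∧ (fun i => u i j) = v := by
  classical
  by_contra! hc
  refine h.ne' ?_
  unfold coordinateAverage
  rw [Finset.sum_eq_zero, mul_zero]
  refine fun x _ => Finset.sum_eq_zero fun u _ => ?_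
  by_cases hR : R x u = 0
  · simp [hR]
  · rw [Finset.sum_eq_zero, mul_zero]
    exact fun j _ => if_neg fun hj => hc x u j hR hj.1 hj.2

/-- A sub-nonsignalling strategy wins at least `n Δ` of `n` repetitions with probability at most
`exp (-n δ² / 2)`, where `δ = ν / 2 ^ m`. -/
theorem prob_wins_le [∀ i, Nonempty (U i)] (G : Game m X U) {ν Δ : ℝ} (hν : 0 < ν)
    (hΔ : G.valueSNS + ν ≤ Δ) {n : ℕ} (hn : 0 < n)
    {P : (∀ i, Fin n → X i) → (∀ i, Fin n → U i) → ℝ} (hP : IsSubNonsignalling P) :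
    prob (G.queryRep n) P (fun x u => (n : ℝ) * Δ ≤ (G.wins n x u : ℝ)) ≤
      Real.exp (-((n : ℝ) * (ν ^ 2 / (2 * 2 ^ (2 * m))))) := by
  classical
  have hn' : (0 : ℝ) < n := Nat.cast_pos.2 hn
  set q := prob (G.queryRep n) P (fun x u => (n : ℝ) * Δ ≤ (G.wins n x u : ℝ)) with hq
  rcases le_or_gt q 0 with hq0 | hq0
  · exact hq0.trans (Real.exp_pos _).le
  have hrep := (G.queryRep_mem n).1
  -- The joint law of queries and responses conditioned on the winning event; its query marginal
  -- need not be a product.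
  let R : (∀ i, Fin n → X i) → (∀ i, Fin n → U i) → ℝ := fun x u =>
    (if (n : ℝ) * Δ ≤ (G.wins n x u : ℝ) then G.queryRep n x * P x u else 0) / q
  have hR0 (x u) : 0 ≤ R x u := by
    refine div_nonneg ?_ hq0.le
    split_ifs
    · exact mul_nonneg (hrep x) (hP.nonneg x u)
    · exact le_rfl
  have hR1 : ∑ x, ∑ u, R x u = 1 := by
    simp only [R, ← Finset.sum_div]
    rw [← div_self hq0.ne']
    nth_rw 2 [hq]
    rfl
  have hRle (x u) : R x u ≤ q⁻¹ * (G.queryRep n x * P x u) := by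
    simp only [R]
    rw [div_eq_inv_mul]
    refine mul_le_mul_of_nonneg_left ?_ (by positivity)
    split_ifs
    · exact le_rfl
    · exact mul_nonneg (hrep x) (hP.nonneg x u)
  have hRq (x u) (h : R x u ≠ 0) (j) : 0 < G.query (fun i => x i j) := by
    refine (G.query_mem.1 _).lt_of_ne' fun h0 => h ?_
    have : G.queryRep n x = 0 := Finset.prod_eq_zero (Finset.mem_univ j) h0
    simp [R, this]
  have hRw (x u) : R x u * (n * Δ) ≤ R x u * G.wins n x u := by
    by_cases hw : (n : ℝ) * Δ ≤ (G.wins n x u : ℝ)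
    · exact mul_le_mul_of_nonneg_left hw (hR0 x u)
    · simp [R, hw]
  set t := coordinateAverage R with ht
  have ht0 : ∀ y v, 0 ≤ t y v := coordinateAverage_nonneg hR0
  have ht1 : ∑ y, ∑ v, t y v = 1 := by
    have := sum_coordinateAverage_mul R fun _ _ => 1
    simp only [mul_one, Finset.sum_const, Finset.card_univ, Fintype.card_fin, nsmul_eq_mul,
      ← Finset.sum_mul] at this
    rw [ht, this, hR1]
    field_simp
  have htq (y v) (h : 0 < t y v) : 0 < G.query y := by
    obtain ⟨x, u, j, h₁, rfl, -⟩ := exists_pos_of_coordinateAverage_pos h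
    exact hRq x u h₁ j
  have htw : Δ ≤ ∑ y, ∑ v, t y v * (if G.ω y v = true then 1 else 0) := by
    rw [ht, sum_coordinateAverage_mul, ← div_eq_inv_mul, le_div_iff₀ hn']
    have := Finset.sum_le_sum fun x (_ : x ∈ Finset.univ) =>
      Finset.sum_le_sum fun u (_ : u ∈ Finset.univ) => hRw x u
    simp only [← Finset.sum_mul, hR1] at this
    simpa [Game.wins, mul_comm Δ] using this
  obtain ⟨S, hS, hSw⟩ := exists_isSubNonsignalling_prob_ge G.query_mem.1 ht0 htq G.ω
  have hSv := G.isGreatest_valueSNS.2 ⟨S, hS, rfl⟩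
  -- The rounded strategy `S` wins at most `Δ - ν`, so the `2 ^ m` losses sum to at least `ν`.
  obtain ⟨A, hA⟩ : ∃ A : Finset (Fin m), ν / 2 ^ m ≤
      ∑ x, ∑ u, t x u * max (1 - ratio G.query t A x (A.restrict u)) 0 := by
    by_contra! hc
    have := Finset.sum_lt_sum_of_nonempty (Finset.univ_nonempty (α := Finset (Fin m)))
      fun A _ => hc A
    simp only [Finset.sum_const, Finset.card_univ, Fintype.card_finset, Fintype.card_fin,
      nsmul_eq_mul, Nat.cast_pow, Nat.cast_ofNat] at this
    rw [mul_div_cancel₀ _ (by positivity)] at this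
    linarith
  have hpin := sq_sum_mul_max_le G.query_mem ht0 ht1 htq A
  have havg := sum_coordinateAverage_mul R fun x u =>
    -Real.log (ratio G.query t A x (A.restrict u))
  rw [← ht] at havg
  rw [havg] at hpin
  have hexp := sum_queryRep_mul_prod_inv_ratio_le_one G ht0 ht1 hP A
  -- Gibbs' variational inequality, termwise: `log (q * H) ≤ q * H - 1`, and `R * q` is at most the
  -- unconditioned weight, under which `H` has mean at most 1.
  have hlog : ∑ x, ∑ u, R x u *
      ∑ j, -Real.log (ratio G.query t A (fun i => x i j) (A.restrict fun i => u i j)) ≤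
      -Real.log q := by
    calc _ ≤ ∑ x, ∑ u, (G.queryRep n x * P x u *
          ∏ j, (ratio G.query t A (fun i => x i j) (A.restrict fun i => u i j))⁻¹ +
          R x u * (-1 - Real.log q)) := by
          refine Finset.sum_le_sum fun x _ => Finset.sum_le_sum fun u _ => ?_
          set H := ∏ j, (ratio G.query t A (fun i => x i j) (A.restrict fun i => u i j))⁻¹ with hH
          rcases (hR0 x u).eq_or_lt with h0 | h0
          · rw [← h0, zero_mul, zero_mul, add_zero]
            exact mul_nonneg (mul_nonneg (hrep x) (hP.nonneg x u))
              (Finset.prod_nonneg fun j _ => inv_nonneg.2 (ratio_nonneg G.query_mem.1 ht0 _ _ _))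
          · have hpos (j) : 0 < ratio G.query t A (fun i => x i j)
                (A.restrict fun i => u i j) :=
              ratio_pos ht0 A (hRq x u h0.ne' j) (coordinateAverage_pos hR0 h0 j)
            have hHpos : 0 < H := Finset.prod_pos fun j _ => inv_pos.2 (hpos j)
            have hs : ∑ j, -Real.log (ratio G.query t A (fun i => x i j)
                (A.restrict fun i => u i j)) = Real.log H := by
              rw [hH, Real.log_prod fun j _ => (inv_pos.2 (hpos j)).ne']
              simp only [Real.log_inv]
            have h₁ := Real.log_le_sub_one_of_pos (mul_pos hq0 hHpos)
            rw [Real.log_mul hq0.ne' hHpos.ne'] at h₁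
            have h₂ : R x u * (q * H) ≤ G.queryRep n x * P x u * H := by
              have := mul_le_mul_of_nonneg_right (hRle x u) (mul_pos hq0 hHpos).le
              refine this.trans_eq ?_
              field_simp
            rw [hs]
            nlinarith
      _ ≤ _ := by
          simp only [Finset.sum_add_distrib, ← Finset.sum_mul, hR1]
          linarith
  have hδ : (ν / 2 ^ m) ^ 2 / 2 ≤ (n : ℝ)⁻¹ * -Real.log q :=
    le_trans (by gcongr) (hpin.trans (mul_le_mul_of_nonneg_left hlog (by positivity)))
  rw [← div_eq_inv_mul, le_div_iff₀ hn'] at hδ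
  rw [← Real.log_le_iff_le_exp hq0]
  have : ν ^ 2 / (2 * 2 ^ (2 * m)) = (ν / 2 ^ m) ^ 2 / 2 := by
    rw [div_pow, ← pow_mul, mul_comm m 2, div_div, mul_comm (2 : ℝ)]
  rw [this]
  linarith

end Repetition

end Multiprover

theorem mainTheorem1 :
    ∃ C : ℕ → ℝ, (∀ m, 0 < C m) ∧ C =O[atTop] (fun m : ℕ => (2 : ℝ) ^ (2 * m)) ∧
      ∀ (m : ℕ) (X : Fin m → Type u) (U : Fin m → Type v)
        [∀ i, Fintype (X i)] [∀ i, Fintype (U i)] [∀ i, Nonempty (U i)]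
        (G : Multiprover.Game m X U), G.valueSNS < 1 →
        ∀ (ν Δ : ℝ), 0 < ν → ν ≤ 1 - G.valueSNS → G.valueSNS + ν ≤ Δ →
          ∀ n : ℕ, G.valueSNSRep n Δ ≤ Real.exp (-((n : ℝ) * (ν ^ 2 / C m))) := by
  -- The factor 2 is Pinsker's; `2 ^ (2 * m)` is the squared number of subsets `A`.
  refine ⟨fun m => 2 * 2 ^ (2 * m), fun m => by positivity,
    (isBigO_refl _ _).const_mul_left _, ?_⟩
  intro m X U _ _ _ G _ ν Δ hν _ hΔ n
  obtain ⟨P, hP, hr⟩ := (G.isGreatest_valueSNSRep n Δ).1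
  rw [hr]
  -- The average over rounds needs `n > 0`; at `n = 0` the bound is 1.
  rcases n.eq_zero_or_pos with rfl | hn
  · simp only [CharP.cast_eq_zero, zero_mul, neg_zero, Real.exp_zero]
    exact Multiprover.prob_le_one (G.queryRep_mem 0) hP _
  · exact Multiprover.prob_wins_le G hν hΔ hn hP
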